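/- Let $\xi>0$ and let $G_\xi(dm)=\xi m^{-\xi-1}1_{\{m>0\}}\,dm$. Let $\Phi$ be a Poisson point process on $\mathbb R^d\times(0,+\infty)$ with intensity $dx\,G_\xi(dm)$, defined on a probability space $(\Omega,\mathcal F,\mathbb P)$. Let $h:\mathbb R^d\to[0,+\infty]$ be continuous. For $A\subset\mathbb R^d$ put $h_A(x)=\sup_{z\in A}h(x+z)$ (with $\sup\emptyset=0$), and let $h^+=h_{\{|z|\le 1\}}$. Suppose that $$\int_{\mathbb R^d}h(x)^\xi\,dx=1\qquad\text{and}\qquad\int_{\mathbb R^d}h^+(x)^\xi\,dx<+\infty .$$ Let $M_\infty(y)=\sup\{m\,h(y-x):(x,m)\in\Phi\}$, $y\in\mathbb R^d$, be the associated extremal shot noise, i.e. $M_\infty\sim\mathrm{ESN}(h,G_\xi)$, and let $F_\xi(u)=\exp(-u^{-\xi})1_{\{u>0\}}$. Then the following hold, and all the integrals below are finite. 1. For every compact $K\subset\mathbb R^d$, there is exactly one real number $\theta(K)$ (the extremal coefficient of $K$) such that $\mathbb P[\sup_{x\in K}M_\infty(x)<u]=\mathbb P[M_\infty(0)<u]^{\theta(K)}$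 for all $u>0$, and $$\theta(K)=\int_{\mathbb R^d}h_K(x)^\xi\,dx .$$ 2. In particular, for every $l\in\mathbb R^d$ there is exactly one real number $\theta(l)$ (the extremal coefficient function at lag $l$) such that $\mathbb P[M_\infty(x)<u,\,M_\infty(x+l)<u]=\mathbb P[M_\infty(0)<u]^{\theta(l)}$ for all $x\in\mathbb R^d$ and $u>0$, and $$\theta(l)=\int_{\mathbb R^d}\bigl(h(x)^\xi\vee h(x+l)^\xi\bigr)\,dx .$$ 3. For every $v\in\mathbb R^d\setminus\{0\}$ there is exactly one real number $\gamma(v)$ (the extremal index in direction $v$) such that $\lim_{n\to+\infty}\mathbb P\bigl(\bigvee_{1\le i\le n}M_\infty(iv)\le n^{1/\xi}u\bigr)=F_\xi(u)^{\gamma(v)}$ for all $u>0$, and $$\gamma(v)=\inf_{n\ge1}\frac1n\int_{\mathbb R^d}\bigvee_{k=1}^n h(x+kv)^\xi\,dx .$$ -/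

import Mathlib

open MeasureTheory ProbabilityTheory Filter Topology
open scoped ENNReal

noncomputable section

/-- A Poisson point process on `ℝ^d × (0, ∞)` with intensity `dx G(dm)`, where `G` is a measure
carried by `(0, ∞)`: a random locally finite subset of `ℝ^d × (0, ∞)` whose counts on Borel sets are
measurable, Poisson distributed with the prescribed mean (almost surely infinite if the mean is
infinite), and independent over disjoint sets. -/
structure IsPoissonPointProcess {Ω : Type*} [MeasurableSpace Ω] (P : Measure Ω) {d : ℕ}
    (G : Measure ℝ) (Φ : Ω → Set (EuclideanSpace ℝ (Fin d) × ℝ)) : Prop where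
  mark_pos : ∀ ω, ∀ φ ∈ Φ ω, 0 < φ.2
  locallyFinite : ∀ ω, ∀ C : Set (EuclideanSpace ℝ (Fin d) × ℝ), IsCompact C →
    (∀ φ ∈ C, 0 < φ.2) → (Φ ω ∩ C).Finite
  measurable_count : ∀ A : Set (EuclideanSpace ℝ (Fin d) × ℝ), MeasurableSet A →
    Measurable fun ω => (Φ ω ∩ A).encard
  count_law : ∀ A : Set (EuclideanSpace ℝ (Fin d) × ℝ), MeasurableSet A →
    (volume.prod G) A ≠ ⊤ →
    P.map (fun ω => (Φ ω ∩ A).encard) =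
      (poissonMeasure ((volume.prod G) A).toNNReal).map (fun k : ℕ => (k : ℕ∞))
  count_top : ∀ A : Set (EuclideanSpace ℝ (Fin d) × ℝ), MeasurableSet A →
    (volume.prod G) A = ⊤ → ∀ᵐ ω ∂P, (Φ ω ∩ A).encard = ⊤
  count_indep : ∀ (n : ℕ) (A : Fin n → Set (EuclideanSpace ℝ (Fin d) × ℝ)),
    (∀ i, MeasurableSet (A i)) → Pairwise (Function.onFun Disjoint A) →
    iIndepFun (fun i ω => (Φ ω ∩ A i).encard) P

/-- The extremal shot noise `M(y) = sup {m h(y - x) ; (x, m) ∈ Φ}`, with values in `[0, ∞]`. -/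
def extremalShotNoise {Ω : Type*} {d : ℕ} (h : EuclideanSpace ℝ (Fin d) → ℝ≥0∞)
    (Φ : Ω → Set (EuclideanSpace ℝ (Fin d) × ℝ)) (ω : Ω) (y : EuclideanSpace ℝ (Fin d)) : ℝ≥0∞ :=
  ⨆ φ ∈ Φ ω, ENNReal.ofReal φ.2 * h (y - φ.1)

/-- The measure `G_ξ(dm) = ξ m^(-ξ-1) 1_{m > 0} dm`. -/
def powerMeasure (ξ : ℝ) : Measure ℝ :=
  (volume.restrict (Set.Ioi 0)).withDensity fun m => ENNReal.ofReal (ξ * m ^ (-ξ - 1))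

/-- The Fréchet distribution function `F_ξ(u) = exp(-u^(-ξ)) 1_{u > 0}`. -/
def frechetCDF (ξ u : ℝ) : ℝ :=
  if 0 < u then Real.exp (-u ^ (-ξ)) else 0

/-- `h_A(x) = sup {h(x + z) ; z ∈ A}`. -/
def supOver {d : ℕ} (h : EuclideanSpace ℝ (Fin d) → ℝ≥0∞) (A : Set (EuclideanSpace ℝ (Fin d)))
    (x : EuclideanSpace ℝ (Fin d)) : ℝ≥0∞ :=
  ⨆ z ∈ A, h (x + z)

/-- `θ` is an extremal coefficient of the random field `M` on the set `K`. -/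
def IsExtremalCoefficient {Ω : Type*} [MeasurableSpace Ω] (P : Measure Ω) {d : ℕ}
    (M : Ω → EuclideanSpace ℝ (Fin d) → ℝ≥0∞) (K : Set (EuclideanSpace ℝ (Fin d))) (θ : ℝ) : Prop :=
  ∀ u : ℝ, 0 < u →
    P.real {ω | (⨆ x ∈ K, M ω x) < ENNReal.ofReal u} = P.real {ω | M ω 0 < ENNReal.ofReal u} ^ θ

/-- `θ` is a value at lag `l` of the (pairwise) extremal coefficient function of `M`. -/
def IsPairwiseExtremalCoefficient {Ω : Type*} [MeasurableSpace Ω] (P : Measure Ω) {d : ℕ}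
    (M : Ω → EuclideanSpace ℝ (Fin d) → ℝ≥0∞) (l : EuclideanSpace ℝ (Fin d)) (θ : ℝ) : Prop :=
  ∀ (x : EuclideanSpace ℝ (Fin d)) (u : ℝ), 0 < u →
    P.real {ω | M ω x < ENNReal.ofReal u ∧ M ω (x + l) < ENNReal.ofReal u} =
      P.real {ω | M ω 0 < ENNReal.ofReal u} ^ θ

/-- `γ` is an extremal index, in the direction `v`, of a random field `M` with Fréchet margins
`F_ξ`. -/
def IsExtremalIndex {Ω : Type*} [MeasurableSpace Ω] (P : Measure Ω) {d : ℕ} (ξ : ℝ)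
    (M : Ω → EuclideanSpace ℝ (Fin d) → ℝ≥0∞) (v : EuclideanSpace ℝ (Fin d)) (γ : ℝ) : Prop :=
  ∀ u : ℝ, 0 < u →
    Tendsto
      (fun n : ℕ =>
        P.real {ω | (⨆ i ∈ Finset.Icc 1 n, M ω (i • v)) ≤ ENNReal.ofReal ((n : ℝ) ^ (1 / ξ) * u)})
      atTop (𝓝 (frechetCDF ξ u ^ γ))

end

/-!
Since `sup_K M = sup {m h_K(-x) ; (x, m) ∈ Φ}`, the event `sup_K M ≤ u` says that `Φ` has no point
in `{m h_K(-x) > u}`. By the scaling of `G_ξ` this set has intensity `u^(-ξ) θ(K)` with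
`θ(K) = ∫ h_K^ξ`, so `sup_K M` has distribution function `F_ξ ^ θ(K)`. The functional `θ` is
translation invariant and subadditive under unions: hence it is finite on compact sets as soon as it
is finite on the unit ball, and Fekete's lemma yields the limit of `θ({v, …, n v}) / n`, which the
max-stability `F_ξ(n^(1/ξ) u) = F_ξ(u)^(1/n)` turns into the extremal index.
-/

section PowerMeasure

variable {ξ : ℝ}

instance sFinite_powerMeasure : SFinite (powerMeasure ξ) := by
  unfold powerMeasure
  infer_instance

lemma powerMeasure_Ioi (hξ : 0 < ξ) {a : ℝ} (ha : 0 < a) :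
    powerMeasure ξ (Set.Ioi a) = ENNReal.ofReal (a ^ (-ξ)) := by
  have hlt : -ξ - 1 < -1 := by linarith
  have hint : ∫ m in Set.Ioi a, ξ * m ^ (-ξ - 1) = a ^ (-ξ) := by
    rw [integral_const_mul, integral_Ioi_rpow_of_lt hlt ha, sub_add_cancel]
    field_simp
  have hnonneg : 0 ≤ᵐ[volume.restrict (Set.Ioi a)] fun m => ξ * m ^ (-ξ - 1) := by
    filter_upwards [ae_restrict_mem measurableSet_Ioi] with m hm
    have hm0 : 0 < m := ha.trans hm
    exact mul_nonneg hξ.le (Real.rpow_nonneg hm0.le _)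
  rw [powerMeasure, withDensity_apply _ measurableSet_Ioi,
    Measure.restrict_restrict measurableSet_Ioi, Set.Ioi_inter_Ioi, sup_eq_left.2 ha.le,
    ← ofReal_integral_eq_lintegral_ofReal
      ((integrableOn_Ioi_rpow_of_lt hlt ha).const_mul ξ) hnonneg, hint]

lemma powerMeasure_Ioi_zero (hξ : 0 < ξ) : powerMeasure ξ (Set.Ioi 0) = ⊤ := by
  have hlim : Tendsto (fun a : ℝ => ENNReal.ofReal (a ^ (-ξ))) (𝓝[>] 0) (𝓝 ⊤) :=
    ENNReal.tendsto_ofReal_nhds_top.2 (tendsto_rpow_neg_nhdsGT_zero (neg_lt_zero.2 hξ))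
  refine top_le_iff.1 (le_of_tendsto hlim ?_)
  filter_upwards [self_mem_nhdsWithin] with a ha
  rw [← powerMeasure_Ioi hξ ha]
  exact measure_mono (Set.Ioi_subset_Ioi (le_of_lt ha))

lemma powerMeasure_setOf_lt_ofReal (hξ : 0 < ξ) (s : ℝ≥0∞) :
    powerMeasure ξ {m | s < ENNReal.ofReal m} = s ^ (-ξ) := by
  induction s with
  | top => simp [hξ]
  | coe s =>
    have hset : {m : ℝ | (s : ℝ≥0∞) < ENNReal.ofReal m} = Set.Ioi (s : ℝ) := by
      ext m
      rw [Set.mem_ofPred_eq, ENNReal.lt_ofReal_iff_toReal_lt ENNReal.coe_ne_top,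
        ENNReal.coe_toReal, Set.mem_Ioi]
    rw [hset]
    rcases eq_or_ne s 0 with rfl | hs
    · simpa [ENNReal.zero_rpow_of_neg, hξ] using powerMeasure_Ioi_zero hξ
    · have hs0 : (0 : ℝ) < s := by positivity
      rw [powerMeasure_Ioi hξ hs0, ← ENNReal.ofReal_rpow_of_pos hs0, ENNReal.ofReal_coe_nnreal]

lemma powerMeasure_setOf_lt_ofReal_mul (hξ : 0 < ξ) {t : ℝ≥0∞} (ht₀ : t ≠ 0) (ht : t ≠ ⊤)
    (c : ℝ≥0∞) :
    powerMeasure ξ {m | t < ENNReal.ofReal m * c} = t ^ (-ξ) * c ^ ξ := by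
  simp_rw [← ENNReal.div_lt_iff (Or.inr ht₀) (Or.inr ht)]
  rw [powerMeasure_setOf_lt_ofReal hξ, ENNReal.rpow_neg, ENNReal.div_rpow_of_nonneg _ _ hξ.le,
    ENNReal.inv_div (Or.inr (ENNReal.rpow_ne_top_of_nonneg hξ.le ht))
      (Or.inr (ENNReal.rpow_pos ht₀.bot_lt ht).ne'),
    div_eq_mul_inv, mul_comm, ENNReal.rpow_neg]

/-- The marked points `(x, m)` at which the storm of intensity `m` and profile `g` exceeds the
level `t`, that is, `t < m g(x)`. -/
def exceedanceSet {E : Type*} (g : E → ℝ≥0∞) (t : ℝ≥0∞) : Set (E × ℝ) :=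
  {φ | t < ENNReal.ofReal φ.2 * g φ.1}

variable {E : Type*} [MeasurableSpace E] {g : E → ℝ≥0∞}

lemma measurableSet_exceedanceSet (hg : Measurable g) (t : ℝ≥0∞) :
    MeasurableSet (exceedanceSet g t) :=
  measurableSet_lt measurable_const
    (measurable_snd.ennreal_ofReal.mul (hg.comp measurable_fst))

lemma prod_powerMeasure_exceedanceSet (hξ : 0 < ξ) (μ : Measure E) (hg : Measurable g)
    {t : ℝ≥0∞} (ht₀ : t ≠ 0) (ht : t ≠ ⊤) :
    μ.prod (powerMeasure ξ) (exceedanceSet g t) = t ^ (-ξ) * ∫⁻ x, g x ^ ξ ∂μ := by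
  rw [Measure.prod_apply (measurableSet_exceedanceSet hg t),
    ← lintegral_const_mul _ (hg.pow_const ξ)]
  exact lintegral_congr fun x => powerMeasure_setOf_lt_ofReal_mul hξ ht₀ ht (g x)

end PowerMeasure

section Frechet

variable {ξ u : ℝ}

lemma frechetCDF_of_pos (hu : 0 < u) : frechetCDF ξ u = Real.exp (-u ^ (-ξ)) :=
  if_pos hu

lemma frechetCDF_pos (hu : 0 < u) : 0 < frechetCDF ξ u := by
  rw [frechetCDF_of_pos hu]
  exact Real.exp_pos _

lemma frechetCDF_lt_one (hu : 0 < u) : frechetCDF ξ u < 1 := by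
  rw [frechetCDF_of_pos hu, Real.exp_lt_one_iff, neg_lt_zero]
  exact Real.rpow_pos_of_pos hu _

lemma frechetCDF_rpow_inj (hu : 0 < u) {a b : ℝ} :
    frechetCDF ξ u ^ a = frechetCDF ξ u ^ b ↔ a = b :=
  Real.rpow_right_inj (frechetCDF_pos hu) (frechetCDF_lt_one hu).ne

lemma continuousAt_frechetCDF (hu : 0 < u) : ContinuousAt (frechetCDF ξ) u := by
  have hexp : ContinuousAt (fun t : ℝ => Real.exp (-t ^ (-ξ))) u :=
    (Real.continuousAt_rpow_const u (-ξ) (Or.inl hu.ne')).neg.rexp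
  refine hexp.congr ?_
  filter_upwards [lt_mem_nhds hu] with t ht
  exact (frechetCDF_of_pos ht).symm

lemma frechetCDF_rpow_one_div_mul (hξ : ξ ≠ 0) {c : ℝ} (hc : 0 < c) (hu : 0 < u) :
    frechetCDF ξ (c ^ (1 / ξ) * u) = frechetCDF ξ u ^ c⁻¹ := by
  have hexponent : 1 / ξ * -ξ = -1 := by field_simp
  rw [frechetCDF_of_pos (by positivity), frechetCDF_of_pos hu, ← Real.exp_mul,
    Real.mul_rpow (by positivity) hu.le, ← Real.rpow_mul hc.le, hexponent, Real.rpow_neg_one,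
    neg_mul, mul_comm]

end Frechet

section RandomField

variable {Ω : Type*} [MeasurableSpace Ω] {P : Measure Ω} {d : ℕ} {ξ : ℝ}
  {M : Ω → EuclideanSpace ℝ (Fin d) → ℝ≥0∞}

lemma isExtremalCoefficient_iff_eq {K : Set (EuclideanSpace ℝ (Fin d))} {a : ℝ}
    (hM : ∀ u, 0 < u → P.real {ω | M ω 0 < ENNReal.ofReal u} = frechetCDF ξ u)
    (hK : ∀ u, 0 < u →
      P.real {ω | (⨆ x ∈ K, M ω x) < ENNReal.ofReal u} = frechetCDF ξ u ^ a) (θ : ℝ) :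
    IsExtremalCoefficient P M K θ ↔ θ = a := by
  refine ⟨fun hθ => ?_, ?_⟩
  · have h₁ := hθ 1 one_pos
    rw [hK 1 one_pos, hM 1 one_pos, frechetCDF_rpow_inj one_pos] at h₁
    exact h₁.symm
  · rintro rfl u hu
    rw [hK u hu, hM u hu]

lemma isPairwiseExtremalCoefficient_iff_forall_pair {l : EuclideanSpace ℝ (Fin d)} {θ : ℝ} :
    IsPairwiseExtremalCoefficient P M l θ ↔ ∀ x, IsExtremalCoefficient P M {x, x + l} θ := by
  simp only [IsPairwiseExtremalCoefficient, IsExtremalCoefficient, iSup_pair, sup_lt_iff]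

variable {v : EuclideanSpace ℝ (Fin d)}

lemma IsExtremalIndex.unique {γ γ' : ℝ} (hγ : IsExtremalIndex P ξ M v γ)
    (hγ' : IsExtremalIndex P ξ M v γ') : γ = γ' :=
  (frechetCDF_rpow_inj one_pos).1 (tendsto_nhds_unique (hγ 1 one_pos) (hγ' 1 one_pos))

lemma isExtremalIndex_of_tendsto_div (hξ : ξ ≠ 0) {a : ℕ → ℝ} {γ : ℝ}
    (hM : ∀ n u, 0 < u →
      P.real {ω | (⨆ i ∈ Finset.Icc 1 n, M ω (i • v)) ≤ ENNReal.ofReal u} = frechetCDF ξ u ^ a n)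
    (ha : Tendsto (fun n => a n / n) atTop (𝓝 γ)) :
    IsExtremalIndex P ξ M v γ := by
  intro u hu
  have hlim : Tendsto (fun n => frechetCDF ξ u ^ (a n / n)) atTop (𝓝 (frechetCDF ξ u ^ γ)) :=
    tendsto_const_nhds.rpow ha (Or.inl (frechetCDF_pos hu).ne')
  refine hlim.congr' ?_
  filter_upwards [eventually_gt_atTop 0] with n hn
  have hn₀ : (0 : ℝ) < n := by exact_mod_cast hn
  rw [hM n _ (by positivity), frechetCDF_rpow_one_div_mul hξ hn₀ hu,
    ← Real.rpow_mul (frechetCDF_pos hu).le, div_eq_inv_mul]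

end RandomField

section ExtremalCoefficient

open scoped Pointwise

variable {d : ℕ} {h : EuclideanSpace ℝ (Fin d) → ℝ≥0∞} {ξ : ℝ}

lemma measurable_supOver (hh : LowerSemicontinuous h) (A : Set (EuclideanSpace ℝ (Fin d))) :
    Measurable (supOver h A) :=
  (lowerSemicontinuous_biSup fun z _ => hh.comp (continuous_add_const z)).measurable

lemma supOver_singleton_zero (h : EuclideanSpace ℝ (Fin d) → ℝ≥0∞) : supOver h {0} = h := by
  ext x
  simp [supOver]

lemma supOver_union (h : EuclideanSpace ℝ (Fin d) → ℝ≥0∞) (A B : Set (EuclideanSpace ℝ (Fin d)))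
    (x : EuclideanSpace ℝ (Fin d)) :
    supOver h (A ∪ B) x = max (supOver h A x) (supOver h B x) :=
  iSup_union

lemma supOver_vadd (h : EuclideanSpace ℝ (Fin d) → ℝ≥0∞) (z : EuclideanSpace ℝ (Fin d))
    (A : Set (EuclideanSpace ℝ (Fin d))) (x : EuclideanSpace ℝ (Fin d)) :
    supOver h (z +ᵥ A) x = supOver h A (x + z) := by
  simp only [supOver, ← Set.image_vadd, iSup_image, vadd_eq_add, add_assoc]

lemma supOver_rpow (h : EuclideanSpace ℝ (Fin d) → ℝ≥0∞) (hξ : 0 < ξ)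
    (A : Set (EuclideanSpace ℝ (Fin d))) (x : EuclideanSpace ℝ (Fin d)) :
    supOver h A x ^ ξ = ⨆ z ∈ A, h (x + z) ^ ξ :=
  (ENNReal.orderIsoRpow ξ hξ).map_iSup₂ fun z (_ : z ∈ A) => h (x + z)

/-- The extremal coefficient `θ(K) = ∫ h_K ^ ξ` of the extremal shot noise `ESN(h, G_ξ)`, as an
extended nonnegative number. -/
noncomputable def extremalCoefficient (ξ : ℝ) (h : EuclideanSpace ℝ (Fin d) → ℝ≥0∞)
    (K : Set (EuclideanSpace ℝ (Fin d))) : ℝ≥0∞ :=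
  ∫⁻ x, supOver h K x ^ ξ

lemma extremalCoefficient_mono (hξ : 0 ≤ ξ) {A B : Set (EuclideanSpace ℝ (Fin d))} (hAB : A ⊆ B) :
    extremalCoefficient ξ h A ≤ extremalCoefficient ξ h B :=
  lintegral_mono fun _ => ENNReal.rpow_le_rpow (biSup_mono hAB) hξ

lemma extremalCoefficient_vadd (z : EuclideanSpace ℝ (Fin d))
    (A : Set (EuclideanSpace ℝ (Fin d))) :
    extremalCoefficient ξ h (z +ᵥ A) = extremalCoefficient ξ h A := by
  simp only [extremalCoefficient, supOver_vadd]
  exact lintegral_add_right_eq_self (fun x => supOver h A x ^ ξ) z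

lemma extremalCoefficient_union_le (hξ : 0 ≤ ξ) {A : Set (EuclideanSpace ℝ (Fin d))}
    (hA : Measurable (supOver h A)) (B : Set (EuclideanSpace ℝ (Fin d))) :
    extremalCoefficient ξ h (A ∪ B) ≤ extremalCoefficient ξ h A + extremalCoefficient ξ h B := by
  simp only [extremalCoefficient]
  rw [← lintegral_add_left (hA.pow_const ξ)]
  refine lintegral_mono fun x => ?_
  rw [supOver_union, (ENNReal.monotone_rpow_of_nonneg hξ).map_max]
  exact max_le_add_of_nonneg zero_le zero_le

lemma extremalCoefficient_lt_top (hξ : 0 < ξ) (hh : LowerSemicontinuous h)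
    (hball : extremalCoefficient ξ h (Metric.closedBall 0 1) < ⊤)
    {K : Set (EuclideanSpace ℝ (Fin d))} (hK : IsCompact K) :
    extremalCoefficient ξ h K < ⊤ := by
  refine hK.induction_on ?empty ?mono ?union ?nhds
  case empty => simp [extremalCoefficient, supOver, hξ]
  case mono => exact fun A B hAB hB => (extremalCoefficient_mono hξ.le hAB).trans_lt hB
  case union =>
    exact fun A B hA hB =>
      (extremalCoefficient_union_le hξ.le (measurable_supOver hh A) B).trans_lt
        (ENNReal.add_lt_top.2 ⟨hA, hB⟩)
  case nhds =>
    intro x _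
    refine ⟨x +ᵥ Metric.closedBall (0 : EuclideanSpace ℝ (Fin d)) 1,
      mem_nhdsWithin_of_mem_nhds ?_, ?_⟩
    · rw [vadd_closedBall_zero]
      exact Metric.closedBall_mem_nhds x one_pos
    · rwa [extremalCoefficient_vadd]

lemma extremalCoefficient_pair (hξ : 0 < ξ) (x l : EuclideanSpace ℝ (Fin d)) :
    extremalCoefficient ξ h {x, x + l} = ∫⁻ y, max (h y ^ ξ) (h (y + l) ^ ξ) := by
  have hpair : ({x, x + l} : Set (EuclideanSpace ℝ (Fin d))) =
      x +ᵥ ({0, l} : Set (EuclideanSpace ℝ (Fin d))) := by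
    rw [← Set.image_vadd, Set.image_pair, vadd_eq_add, vadd_eq_add, add_zero]
  rw [hpair, extremalCoefficient_vadd, extremalCoefficient]
  simp only [supOver_rpow h hξ, iSup_pair, add_zero]

/-- The set `{v, 2 v, …, n v}`. -/
def firstMultiples {E : Type*} [AddMonoid E] (v : E) (n : ℕ) : Set E :=
  (fun k : ℕ => k • v) '' Finset.Icc 1 n

lemma iSup_firstMultiples {E α : Type*} [AddMonoid E] [CompleteLattice α] (v : E) (n : ℕ)
    (f : E → α) : ⨆ y ∈ firstMultiples v n, f y = ⨆ k ∈ Finset.Icc 1 n, f (k • v) := by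
  simp only [firstMultiples, iSup_image, Finset.mem_coe]

lemma firstMultiples_add {E : Type*} [AddMonoid E] (v : E) (m n : ℕ) :
    firstMultiples v (m + n) = firstMultiples v m ∪ (m • v +ᵥ firstMultiples v n) := by
  have hIcc : Set.Icc 1 (m + n) = Set.Icc 1 m ∪ (m + ·) '' Set.Icc 1 n := by
    rw [Set.image_const_add_Icc]
    ext k
    simp only [Set.mem_union, Set.mem_Icc]
    omega
  simp only [firstMultiples, Finset.coe_Icc, hIcc, Set.image_union, ← Set.image_vadd,
    Set.image_image, vadd_eq_add, add_nsmul]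

lemma extremalCoefficient_firstMultiples (hξ : 0 < ξ) (v : EuclideanSpace ℝ (Fin d)) (n : ℕ) :
    extremalCoefficient ξ h (firstMultiples v n) =
      ∫⁻ x, ⨆ k ∈ Finset.Icc 1 n, h (x + k • v) ^ ξ :=
  lintegral_congr fun x => by
    rw [supOver_rpow h hξ, iSup_firstMultiples v n fun z => h (x + z) ^ ξ]

lemma extremalCoefficient_firstMultiples_add_le (hξ : 0 ≤ ξ) (hh : LowerSemicontinuous h)
    (v : EuclideanSpace ℝ (Fin d)) (m n : ℕ) :
    extremalCoefficient ξ h (firstMultiples v (m + n)) ≤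
      extremalCoefficient ξ h (firstMultiples v m) +
        extremalCoefficient ξ h (firstMultiples v n) := by
  rw [firstMultiples_add, ← extremalCoefficient_vadd (m • v) (firstMultiples v n)]
  exact extremalCoefficient_union_le hξ (measurable_supOver hh _) _

end ExtremalCoefficient

lemma tendsto_toReal_div_of_subadditive {a : ℕ → ℝ≥0∞} (ha : ∀ n, a n ≠ ⊤)
    (hsub : ∀ m n, a (m + n) ≤ a m + a n) :
    Tendsto (fun n : ℕ => (a n).toReal / n) atTop
      (𝓝 (⨅ (n : ℕ) (_ : 1 ≤ n), (n : ℝ≥0∞)⁻¹ * a n).toReal) := by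
  have hS : Subadditive fun n => (a n).toReal := fun m n => by
    rw [← ENNReal.toReal_add (ha m) (ha n)]
    exact ENNReal.toReal_mono (ENNReal.add_ne_top.2 ⟨ha m, ha n⟩) (hsub m n)
  have hbdd : BddBelow (Set.range fun n : ℕ => (a n).toReal / n) :=
    ⟨0, by rintro _ ⟨n, rfl⟩; positivity⟩
  have hlim : hS.lim = (⨅ (n : ℕ) (_ : 1 ≤ n), (n : ℝ≥0∞)⁻¹ * a n).toReal := by
    have hne_top : ∀ n : {n : ℕ // 1 ≤ n}, ((n : ℕ) : ℝ≥0∞)⁻¹ * a n ≠ ⊤ := fun n =>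
      ENNReal.mul_ne_top
        (ENNReal.inv_ne_top.2 (Nat.cast_ne_zero.2 (Nat.one_le_iff_ne_zero.1 n.2))) (ha n)
    rw [Subadditive.lim, sInf_image', iInf_subtype', ENNReal.toReal_iInf hne_top]
    refine iInf_congr fun n => ?_
    rw [ENNReal.toReal_mul, ENNReal.toReal_inv, ENNReal.toReal_natCast, div_eq_inv_mul]
  exact hlim ▸ hS.tendsto_lim hbdd

section ShotNoise

variable {Ω : Type*} {d : ℕ} {Φ : Ω → Set (EuclideanSpace ℝ (Fin d) × ℝ)} {ξ : ℝ}
  {h : EuclideanSpace ℝ (Fin d) → ℝ≥0∞} {K : Set (EuclideanSpace ℝ (Fin d))}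

lemma iSup_extremalShotNoise (h : EuclideanSpace ℝ (Fin d) → ℝ≥0∞)
    (Φ : Ω → Set (EuclideanSpace ℝ (Fin d) × ℝ)) (ω : Ω) (K : Set (EuclideanSpace ℝ (Fin d))) :
    ⨆ y ∈ K, extremalShotNoise h Φ ω y =
      ⨆ φ ∈ Φ ω, ENNReal.ofReal φ.2 * supOver h K (-φ.1) := by
  simp only [extremalShotNoise, supOver, ENNReal.mul_iSup, sub_eq_neg_add]
  exact iSup₂_comm _

lemma iSup_extremalShotNoise_le_iff {ω : Ω} {t : ℝ≥0∞} :
    (⨆ y ∈ K, extremalShotNoise h Φ ω y) ≤ t ↔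
      Φ ω ∩ exceedanceSet (fun x => supOver h K (-x)) t = ∅ := by
  simp only [iSup_extremalShotNoise, iSup_le_iff, exceedanceSet, Set.eq_empty_iff_forall_notMem,
    Set.mem_inter_iff, Set.mem_ofPred_eq, not_and, not_lt]

namespace IsPoissonPointProcess

variable [MeasurableSpace Ω] {P : Measure Ω}

lemma measureReal_inter_eq_empty {G : Measure ℝ} (hΦ : IsPoissonPointProcess P G Φ)
    {A : Set (EuclideanSpace ℝ (Fin d) × ℝ)} (hA : MeasurableSet A)
    (hfin : volume.prod G A ≠ ⊤) :
    P.real {ω | Φ ω ∩ A = ∅} = Real.exp (-(volume.prod G A).toReal) := by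
  have hvoid : {ω | Φ ω ∩ A = ∅} = (fun ω => (Φ ω ∩ A).encard) ⁻¹' {0} := by
    ext ω
    simp
  have hzero : (fun k : ℕ => (k : ℕ∞)) ⁻¹' {0} = {0} := by
    ext k
    simp
  rw [hvoid, ← map_measureReal_apply (hΦ.measurable_count A hA) (measurableSet_singleton 0),
    hΦ.count_law A hA hfin,
    map_measureReal_apply Measurable.of_discrete (measurableSet_singleton 0), hzero,
    poissonMeasure_real_singleton]
  simp [ENNReal.coe_toNNReal_eq_toReal]

lemma measureReal_iSup_le (hΦ : IsPoissonPointProcess P (powerMeasure ξ) Φ) (hξ : 0 < ξ)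
    (hK : Measurable (supOver h K))
    (hfin : extremalCoefficient ξ h K ≠ ⊤) {u : ℝ} (hu : 0 < u) :
    P.real {ω | (⨆ y ∈ K, extremalShotNoise h Φ ω y) ≤ ENNReal.ofReal u} =
      frechetCDF ξ u ^ (extremalCoefficient ξ h K).toReal := by
  have hg : Measurable fun x => supOver h K (-x) := hK.comp measurable_neg
  have hintensity : volume.prod (powerMeasure ξ)
      (exceedanceSet (fun x => supOver h K (-x)) (ENNReal.ofReal u)) =
        ENNReal.ofReal (u ^ (-ξ)) * extremalCoefficient ξ h K := by
    rw [prod_powerMeasure_exceedanceSet hξ volume hg (ENNReal.ofReal_pos.2 hu).ne'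
      ENNReal.ofReal_ne_top, ENNReal.ofReal_rpow_of_pos hu,
      lintegral_neg_eq_self fun x => supOver h K x ^ ξ, extremalCoefficient]
  simp only [iSup_extremalShotNoise_le_iff]
  rw [hΦ.measureReal_inter_eq_empty (measurableSet_exceedanceSet hg _)
      (hintensity ▸ ENNReal.mul_ne_top ENNReal.ofReal_ne_top hfin), hintensity,
    ENNReal.toReal_mul, ENNReal.toReal_ofReal (Real.rpow_nonneg hu.le _), frechetCDF_of_pos hu,
    ← Real.exp_mul, neg_mul]

lemma measureReal_iSup_lt [IsFiniteMeasure P]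
    (hΦ : IsPoissonPointProcess P (powerMeasure ξ) Φ) (hξ : 0 < ξ) (hK : Measurable (supOver h K))
    (hfin : extremalCoefficient ξ h K ≠ ⊤) {u : ℝ} (hu : 0 < u) :
    P.real {ω | (⨆ y ∈ K, extremalShotNoise h Φ ω y) < ENNReal.ofReal u} =
      frechetCDF ξ u ^ (extremalCoefficient ξ h K).toReal := by
  refine le_antisymm ?_ ?_
  · rw [← hΦ.measureReal_iSup_le hξ hK hfin hu]
    exact measureReal_mono (Set.ofPred_subset_ofPred.2 fun _ => le_of_lt)
  · have hlim : Tendsto (fun t => frechetCDF ξ t ^ (extremalCoefficient ξ h K).toReal) (𝓝[<] u)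
        (𝓝 (frechetCDF ξ u ^ (extremalCoefficient ξ h K).toReal)) :=
      ((continuousAt_frechetCDF hu).rpow_const
        (Or.inl (frechetCDF_pos hu).ne')).tendsto.mono_left nhdsWithin_le_nhds
    refine le_of_tendsto hlim ?_
    filter_upwards [Ioo_mem_nhdsLT hu] with t ht
    rw [← hΦ.measureReal_iSup_le hξ hK hfin ht.1]
    exact measureReal_mono fun ω hω =>
      lt_of_le_of_lt hω ((ENNReal.ofReal_lt_ofReal_iff hu).2 ht.2)

lemma measureReal_extremalShotNoise_zero_lt [IsFiniteMeasure P]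
    (hΦ : IsPoissonPointProcess P (powerMeasure ξ) Φ) (hξ : 0 < ξ) (hh : Measurable h)
    (hone : ∫⁻ x, h x ^ ξ = 1) {u : ℝ} (hu : 0 < u) :
    P.real {ω | extremalShotNoise h Φ ω 0 < ENNReal.ofReal u} = frechetCDF ξ u := by
  have hcoeff : extremalCoefficient ξ h {0} = 1 := by
    rw [extremalCoefficient, supOver_singleton_zero, hone]
  have hlaw := hΦ.measureReal_iSup_lt hξ (K := {0})
    ((supOver_singleton_zero h).symm ▸ hh) (hcoeff ▸ ENNReal.one_ne_top) hu
  simpa only [hcoeff, iSup_singleton, ENNReal.toReal_one, Real.rpow_one] using hlaw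

lemma isExtremalCoefficient_iff [IsFiniteMeasure P]
    (hΦ : IsPoissonPointProcess P (powerMeasure ξ) Φ) (hξ : 0 < ξ) (hh : Measurable h)
    (hone : ∫⁻ x, h x ^ ξ = 1) (hK : Measurable (supOver h K))
    (hfin : extremalCoefficient ξ h K ≠ ⊤) (θ : ℝ) :
    IsExtremalCoefficient P (extremalShotNoise h Φ) K θ ↔
      θ = (extremalCoefficient ξ h K).toReal :=
  isExtremalCoefficient_iff_eq
    (fun _ => hΦ.measureReal_extremalShotNoise_zero_lt hξ hh hone)
    (fun _ => hΦ.measureReal_iSup_lt hξ hK hfin) θ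

lemma isExtremalIndex_iff (hΦ : IsPoissonPointProcess P (powerMeasure ξ) Φ) (hξ : 0 < ξ)
    (hh : LowerSemicontinuous h) {v : EuclideanSpace ℝ (Fin d)}
    (hfin : ∀ n, extremalCoefficient ξ h (firstMultiples v n) ≠ ⊤) (γ : ℝ) :
    IsExtremalIndex P ξ (extremalShotNoise h Φ) v γ ↔
      γ = (⨅ (n : ℕ) (_ : 1 ≤ n),
        (n : ℝ≥0∞)⁻¹ * extremalCoefficient ξ h (firstMultiples v n)).toReal := by
  have hlaw (n : ℕ) (u : ℝ) (hu : 0 < u) :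
      P.real {ω | (⨆ i ∈ Finset.Icc 1 n, extremalShotNoise h Φ ω (i • v)) ≤ ENNReal.ofReal u} =
        frechetCDF ξ u ^ (extremalCoefficient ξ h (firstMultiples v n)).toReal := by
    simp only [← iSup_firstMultiples]
    exact hΦ.measureReal_iSup_le hξ (measurable_supOver hh _) (hfin n) hu
  have hindex := isExtremalIndex_of_tendsto_div hξ.ne' hlaw
    (tendsto_toReal_div_of_subadditive hfin
      (extremalCoefficient_firstMultiples_add_le hξ.le hh v))
  exact ⟨fun hγ => hγ.unique hindex, fun hγ => hγ ▸ hindex⟩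

end IsPoissonPointProcess

end ShotNoise

theorem proposition4p2_general {Ω : Type*} [MeasurableSpace Ω] (P : Measure Ω)
    [IsProbabilityMeasure P] {d : ℕ} (ξ : ℝ) (hξ : 0 < ξ)
    (Φ : Ω → Set (EuclideanSpace ℝ (Fin d) × ℝ))
    (hΦ : IsPoissonPointProcess P (powerMeasure ξ) Φ)
    (h : EuclideanSpace ℝ (Fin d) → ℝ≥0∞) (hh : LowerSemicontinuous h)
    (hone : (∫⁻ x, h x ^ ξ) = 1)
    (hplus : (∫⁻ x, supOver h (Metric.closedBall 0 1) x ^ ξ) < ⊤) :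
    (∀ K : Set (EuclideanSpace ℝ (Fin d)), IsCompact K →
      (∫⁻ x, supOver h K x ^ ξ) < ⊤ ∧
      ∀ θ : ℝ, IsExtremalCoefficient P (extremalShotNoise h Φ) K θ ↔
        θ = (∫⁻ x, supOver h K x ^ ξ).toReal) ∧
    (∀ l : EuclideanSpace ℝ (Fin d),
      (∫⁻ x, max (h x ^ ξ) (h (x + l) ^ ξ)) < ⊤ ∧
      ∀ θ : ℝ, IsPairwiseExtremalCoefficient P (extremalShotNoise h Φ) l θ ↔
        θ = (∫⁻ x, max (h x ^ ξ) (h (x + l) ^ ξ)).toReal) ∧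
    (∀ v : EuclideanSpace ℝ (Fin d),
      (∀ n : ℕ, (∫⁻ x, ⨆ k ∈ Finset.Icc 1 n, h (x + k • v) ^ ξ) < ⊤) ∧
      ∀ γ : ℝ, IsExtremalIndex P ξ (extremalShotNoise h Φ) v γ ↔
        γ = (⨅ (n : ℕ) (_ : 1 ≤ n),
          (n : ℝ≥0∞)⁻¹ * ∫⁻ x, ⨆ k ∈ Finset.Icc 1 n, h (x + k • v) ^ ξ).toReal) := by
  have hfin {K : Set (EuclideanSpace ℝ (Fin d))} (hK : IsCompact K) :
      extremalCoefficient ξ h K < ⊤ :=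
    extremalCoefficient_lt_top hξ hh hplus hK
  have hcoeff {K : Set (EuclideanSpace ℝ (Fin d))} (hK : IsCompact K) (θ : ℝ) :
      IsExtremalCoefficient P (extremalShotNoise h Φ) K θ ↔
        θ = (extremalCoefficient ξ h K).toReal :=
    hΦ.isExtremalCoefficient_iff hξ hh.measurable hone (measurable_supOver hh K) (hfin hK).ne θ
  refine ⟨fun K hK => ⟨hfin hK, hcoeff hK⟩, fun l => ?_, fun v => ?_⟩
  · have hpair (x : EuclideanSpace ℝ (Fin d)) : IsCompact {x, x + l} :=
      (Set.toFinite _).isCompact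
    refine ⟨extremalCoefficient_pair hξ 0 l ▸ hfin (hpair 0), fun θ => ?_⟩
    simp only [isPairwiseExtremalCoefficient_iff_forall_pair, hcoeff (hpair _),
      extremalCoefficient_pair hξ, forall_const]
  · have hmultiples (n : ℕ) : extremalCoefficient ξ h (firstMultiples v n) < ⊤ :=
      hfin (((Finset.finite_toSet _).image _).isCompact)
    simp only [← extremalCoefficient_firstMultiples hξ]
    exact ⟨hmultiples, hΦ.isExtremalIndex_iff hξ hh fun n => (hmultiples n).ne⟩

theorem proposition4p2 {Ω : Type*} [MeasurableSpace Ω] (P : Measure Ω) [IsProbabilityMeasure P]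
    {d : ℕ} (ξ : ℝ) (hξ : 0 < ξ)
    (Φ : Ω → Set (EuclideanSpace ℝ (Fin d) × ℝ))
    (hΦ : IsPoissonPointProcess P (powerMeasure ξ) Φ)
    (h : EuclideanSpace ℝ (Fin d) → ℝ≥0∞) (hcont : Continuous h)
    (hone : (∫⁻ x, h x ^ ξ) = 1)
    (hplus : (∫⁻ x, supOver h (Metric.closedBall 0 1) x ^ ξ) < ⊤) :
    (∀ K : Set (EuclideanSpace ℝ (Fin d)), IsCompact K →
      (∫⁻ x, supOver h K x ^ ξ) < ⊤ ∧
      ∀ θ : ℝ, IsExtremalCoefficient P (extremalShotNoise h Φ) K θ ↔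
        θ = (∫⁻ x, supOver h K x ^ ξ).toReal) ∧
    (∀ l : EuclideanSpace ℝ (Fin d),
      (∫⁻ x, max (h x ^ ξ) (h (x + l) ^ ξ)) < ⊤ ∧
      ∀ θ : ℝ, IsPairwiseExtremalCoefficient P (extremalShotNoise h Φ) l θ ↔
        θ = (∫⁻ x, max (h x ^ ξ) (h (x + l) ^ ξ)).toReal) ∧
    (∀ v : EuclideanSpace ℝ (Fin d), v ≠ 0 →
      (∀ n : ℕ, (∫⁻ x, ⨆ k ∈ Finset.Icc 1 n, h (x + k • v) ^ ξ) < ⊤) ∧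
      ∀ γ : ℝ, IsExtremalIndex P ξ (extremalShotNoise h Φ) v γ ↔
        γ = (⨅ (n : ℕ) (_ : 1 ≤ n),
          (n : ℝ≥0∞)⁻¹ * ∫⁻ x, ⨆ k ∈ Finset.Icc 1 n, h (x + k • v) ^ ξ).toReal) := by
  obtain ⟨hcompact, hlag, hindex⟩ :=
    proposition4p2_general P ξ hξ Φ hΦ h hcont.lowerSemicontinuous hone hplus
  exact ⟨hcompact, hlag, fun v _ => hindex v⟩
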